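/- For a Banach space $X$ over $\mathbb K\in\{\mathbb R,\mathbb C\}$ with dual $X^*$ and a real number $q\ge 1$, we use the following definitions. A sequence $(x_n)_n$ in $X$ is weakly $q$-summable if $\sum_n|x^*(x_n)|^q<\infty$ for every $x^*\in X^*$. A bounded set $A\subset X$ is a Dunford–Pettis set if $\lim_n\sup_{x\in A}|x_n^*(x)|=0$ for every weakly null sequence $(x_n^*)_n$ in $X^*$. A sequence $(x_n)_n$ is $q$-Right null if it is weakly $q$-summable and $\{x_n:n\in\mathbb N\}$ is a Dunford–Pettis set. A bounded set $K\subset X^*$ is a $q$-Right set if $\lim_n\sup_{x^*\in K}|x^*(x_n)|=0$ for every $q$-Right null sequence $(x_n)_n$ in $X$. **Theorem.** Let $1<p<\infty$, let $p^*=p/(p-1)$, let $1\le q<p^*$, let $(X_n)_{n}$ be a sequence of Banach spaces, and let $X=(\bigoplus_{n}X_n)_{\ell_p}$. For each $n$ let $P_n:X^*\to X_n^*$ be the $n$-th coordinate projection, where $X^*$ is identified with $(\bigoplus_n X_n^*)_{\ell_{p^*}}$ in the canonical way; that is, $(P_nx^*)(u)=x^*(0,\dots,0,u,0,\dots)$ with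 $u\in X_n$ in the $n$-th place. Then a bounded subset $K$ of $X^*$ is a $q$-Right set if and only if $P_n(K)$ is a $q$-Right set in $X_n^*$ for every $n$. -/

import Mathlib

open Filter Topology
open scoped ENNReal

noncomputable section

namespace RightSets

variable {𝕜 : Type*} [RCLike 𝕜] {X : Type*} [NormedAddCommGroup X] [NormedSpace 𝕜 X]

/-- A sequence in a normed space is weakly null if every continuous linear functional
maps it to a null sequence of scalars. -/
def IsWeaklyNull (𝕜 : Type*) [RCLike 𝕜] {X : Type*} [NormedAddCommGroup X] [NormedSpace 𝕜 X]
    (x : ℕ → X) : Prop :=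
  ∀ f : StrongDual 𝕜 X, Tendsto (fun n => f (x n)) atTop (𝓝 0)

/-- A subset `A` of `X` is a Dunford-Pettis set if it is bounded and every weakly null sequence
in the dual of `X` (weakly null with respect to the bidual) converges to zero uniformly on `A`. -/
def IsDunfordPettisSet (𝕜 : Type*) [RCLike 𝕜] {X : Type*} [NormedAddCommGroup X]
    [NormedSpace 𝕜 X] (A : Set X) : Prop :=
  Bornology.IsBounded A ∧
    ∀ f : ℕ → StrongDual 𝕜 X, IsWeaklyNull 𝕜 f →
      TendstoUniformlyOn (fun n x => f n x) (fun _ => (0 : 𝕜)) atTop A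

/-- For a real exponent `1 ≤ q`: the sequence `x` is weakly `q`-summable if the scalar sequence
`f (x n)` belongs to `ℓ_q` for every `f` in the dual of `X`. -/
def IsWeaklySummable (𝕜 : Type*) [RCLike 𝕜] {X : Type*} [NormedAddCommGroup X]
    [NormedSpace 𝕜 X] (q : ℝ) (x : ℕ → X) : Prop :=
  ∀ f : StrongDual 𝕜 X, Summable fun n => ‖f (x n)‖ ^ q

/-- A sequence is `q`-Right null if it is weakly `q`-summable and its set of terms is a
Dunford-Pettis set. -/
def IsRightNull (𝕜 : Type*) [RCLike 𝕜] {X : Type*} [NormedAddCommGroup X]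
    [NormedSpace 𝕜 X] (q : ℝ) (x : ℕ → X) : Prop :=
  IsDunfordPettisSet 𝕜 (Set.range x) ∧ IsWeaklySummable 𝕜 q x

/-- A subset `K` of the dual of `X` is a `q`-Right set if it is bounded and every `q`-Right null
sequence of `X` converges to zero uniformly on `K`. -/
def IsRightSet (q : ℝ) (K : Set (StrongDual 𝕜 X)) : Prop :=
  Bornology.IsBounded K ∧
    ∀ x : ℕ → X, IsRightNull 𝕜 q x →
      TendstoUniformlyOn (fun n (f : StrongDual 𝕜 X) => f (x n)) (fun _ => (0 : 𝕜)) atTop K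

/-- The `n`-th coordinate projection from the dual of the `ℓ_p`-sum of the `X k` to the dual of
`X n`: a functional `f` is sent to its `n`-th coordinate, the functional `u ↦ f (0, …, 0, u, 0, …)`
with `u` in position `n`. Under the canonical identification of the dual of the `ℓ_p`-sum with
the `ℓ_{p*}`-sum of the duals, `(f k)` acting by `x ↦ ∑ f k (x k)`, it is the projection to the
`n`-th coordinate; see `hasSum_dualProj`. -/
def dualProj {X : ℕ → Type*} [∀ n, NormedAddCommGroup (X n)] [∀ n, NormedSpace 𝕜 (X n)]
    {p : ℝ≥0∞} [Fact (1 ≤ p)] (n : ℕ) (f : StrongDual 𝕜 (lp X p)) : StrongDual 𝕜 (X n) :=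
  f.comp (lp.singleContinuousLinearMap 𝕜 X p n)

theorem hasSum_dualProj {X : ℕ → Type*} [∀ n, NormedAddCommGroup (X n)]
    [∀ n, NormedSpace 𝕜 (X n)] {p : ℝ≥0∞} [Fact (1 ≤ p)] (hp : p ≠ ⊤)
    (f : StrongDual 𝕜 (lp X p)) (x : lp X p) :
    HasSum (fun k => dualProj k f (x k)) (f x) :=
  f.hasSum (lp.hasSum_single hp x)

end RightSets

end

/-!
Adjoints map `q`-Right sets to `q`-Right sets, which gives one implication. For the other one,
suppose that the coordinates of a `q`-Right null sequence `x` tend to zero uniformly on `K`, but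
`x` does not. A gliding hump argument produces a subsequence `(y i)`, functionals `f i ∈ K` and
successive blocks of coordinates such that `g i`, the restriction of `f i` to the `i`-th block,
satisfies `|g i (y i)| ≥ δ`. As the blocks are disjoint, sums of `N` of the `g i` have norm
`O(N ^ (1 / p*))`. Averaging `∑ i, |∑ j ∈ S, g j (y i)| ^ q` over all sets `S` of `N` indices bounds
it below by a multiple of `N` for some `S`, while weak `q`-summability bounds it above by a multiple
of `N ^ (q / p*)`; this is absurd since `q < p*`.
-/

namespace RightSets

theorem tendstoUniformlyOn_image_iff {ι α β γ : Type*} [UniformSpace γ] {F : ι → β → γ}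
    {f : β → γ} {l : Filter ι} {g : α → β} {s : Set α} :
    TendstoUniformlyOn F f l (g '' s) ↔
      TendstoUniformlyOn (fun i a => F i (g a)) (fun a => f (g a)) l s := by
  simp only [TendstoUniformlyOn, Set.forall_mem_image]

section Adjoint

variable {𝕜 : Type*} [RCLike 𝕜] {X Y : Type*} [NormedAddCommGroup X] [NormedSpace 𝕜 X]
  [NormedAddCommGroup Y] [NormedSpace 𝕜 Y]

theorem IsWeaklyNull.map {x : ℕ → X} (hx : IsWeaklyNull 𝕜 x) (T : X →L[𝕜] Y) :
    IsWeaklyNull 𝕜 fun n => T (x n) :=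
  fun f => hx (f.comp T)

theorem IsWeaklySummable.map {q : ℝ} {x : ℕ → X} (hx : IsWeaklySummable 𝕜 q x) (T : X →L[𝕜] Y) :
    IsWeaklySummable 𝕜 q fun n => T (x n) :=
  fun f => hx (f.comp T)

theorem IsDunfordPettisSet.image {A : Set X} (hA : IsDunfordPettisSet 𝕜 A) (T : X →L[𝕜] Y) :
    IsDunfordPettisSet 𝕜 (T '' A) :=
  ⟨T.lipschitz.isBounded_image hA.1, fun f hf =>
    tendstoUniformlyOn_image_iff.2 <|
      hA.2 (fun n => (f n).comp T) (hf.map (ContinuousLinearMap.precomp 𝕜 T))⟩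

theorem IsRightNull.map {q : ℝ} {x : ℕ → X} (hx : IsRightNull 𝕜 q x) (T : X →L[𝕜] Y) :
    IsRightNull 𝕜 q fun n => T (x n) := by
  refine ⟨?_, hx.2.map T⟩
  have hrange := hx.1.image T
  rwa [← Set.range_comp] at hrange

theorem IsRightSet.image_comp {q : ℝ} {K : Set (StrongDual 𝕜 Y)} (hK : IsRightSet q K)
    (T : X →L[𝕜] Y) : IsRightSet q ((fun f : StrongDual 𝕜 Y => f.comp T) '' K) :=
  ⟨(ContinuousLinearMap.precomp 𝕜 T).lipschitz.isBounded_image hK.1, fun _ hx =>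
    tendstoUniformlyOn_image_iff.2 (hK.2 _ (hx.map T))⟩

end Adjoint

section DiagonalAverage

variable {ι E : Type*} [SeminormedAddCommGroup E]

theorem two_mul_half_norm_sub_rpow_le {q : ℝ} (hq : 1 ≤ q) (u v : E) :
    2 * (‖u - v‖ / 2) ^ q ≤ ‖u‖ ^ q + ‖v‖ ^ q := by
  have hconvex : (1 / 2 * ‖u‖ + 1 / 2 * ‖v‖) ^ q ≤ 1 / 2 * ‖u‖ ^ q + 1 / 2 * ‖v‖ ^ q :=
    (convexOn_rpow hq).2 (norm_nonneg u) (norm_nonneg v) (by norm_num) (by norm_num) (by norm_num)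
  have hmono : (‖u - v‖ / 2) ^ q ≤ (1 / 2 * ‖u‖ + 1 / 2 * ‖v‖) ^ q := by
    gcongr
    linarith [norm_sub_le u v]
  linarith

theorem card_powerset_mul_half_norm_rpow_le {q : ℝ} (hq : 1 ≤ q) (v : ι → E)
    {s : Finset ι} {i : ι} (hi : i ∈ s) :
    s.powerset.card * (‖v i‖ / 2) ^ q ≤ ∑ S ∈ s.powerset, ‖∑ j ∈ S, v j‖ ^ q := by
  classical
  obtain ⟨t, hit, rfl⟩ : ∃ t, i ∉ t ∧ insert i t = s :=
    ⟨s.erase i, s.notMem_erase i, Finset.insert_erase hi⟩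
  have hpair : ∀ S ∈ t.powerset,
      2 * (‖v i‖ / 2) ^ q ≤ ‖∑ j ∈ insert i S, v j‖ ^ q + ‖∑ j ∈ S, v j‖ ^ q := by
    intro S hS
    have hiS : i ∉ S := fun h => hit (Finset.mem_powerset.1 hS h)
    simpa only [Finset.sum_insert hiS, add_sub_cancel_right] using
      two_mul_half_norm_sub_rpow_le hq (∑ j ∈ insert i S, v j) (∑ j ∈ S, v j)
  calc (insert i t).powerset.card * (‖v i‖ / 2) ^ q
      = ∑ _S ∈ t.powerset, 2 * (‖v i‖ / 2) ^ q := by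
        simp only [Finset.card_powerset, Finset.card_insert_of_notMem hit, Finset.sum_const,
          nsmul_eq_mul]
        push_cast
        ring
    _ ≤ ∑ S ∈ t.powerset, (‖∑ j ∈ insert i S, v j‖ ^ q + ‖∑ j ∈ S, v j‖ ^ q) :=
        Finset.sum_le_sum hpair
    _ = ∑ S ∈ (insert i t).powerset, ‖∑ j ∈ S, v j‖ ^ q := by
        rw [Finset.sum_add_distrib, Finset.sum_powerset_insert hit, add_comm]

theorem exists_subset_sum_half_norm_diag_rpow_le {q : ℝ} (hq : 1 ≤ q) (s : Finset ι)
    (v : ι → ι → E) :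
    ∃ S ⊆ s, ∑ i ∈ s, (‖v i i‖ / 2) ^ q ≤ ∑ i ∈ s, ‖∑ j ∈ S, v i j‖ ^ q := by
  have haverage : ∑ _S ∈ s.powerset, ∑ i ∈ s, (‖v i i‖ / 2) ^ q ≤
      ∑ S ∈ s.powerset, ∑ i ∈ s, ‖∑ j ∈ S, v i j‖ ^ q := by
    rw [Finset.sum_comm, Finset.sum_comm (s := s.powerset)]
    refine Finset.sum_le_sum fun i hi => ?_
    rw [Finset.sum_const, nsmul_eq_mul]
    exact card_powerset_mul_half_norm_rpow_le hq (v i) hi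
  obtain ⟨S, hS, hle⟩ := Finset.exists_le_of_sum_le (Finset.powerset_nonempty s) haverage
  exact ⟨S, Finset.mem_powerset.1 hS, hle⟩

end DiagonalAverage

section WeaklySummable

variable {𝕜 : Type*} [RCLike 𝕜] {X : Type*} [NormedAddCommGroup X] [NormedSpace 𝕜 X]
  {q r : ℝ} {x : ℕ → X}

theorem IsWeaklySummable.comp_injective (hx : IsWeaklySummable 𝕜 q x) {φ : ℕ → ℕ}
    (hφ : Function.Injective φ) : IsWeaklySummable 𝕜 q (x ∘ φ) :=
  fun f => (hx f).comp_injective hφ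

theorem IsWeaklySummable.mono (hx : IsWeaklySummable 𝕜 q x) (hq : 0 < q) (hqr : q ≤ r) :
    IsWeaklySummable 𝕜 r x := by
  intro f
  have hr : 0 < r := hq.trans_le hqr
  have hmem : Memℓp (fun n => f (x n)) (ENNReal.ofReal q) := memℓp_gen <| by
    simpa only [ENNReal.toReal_ofReal hq.le] using hx f
  simpa only [ENNReal.toReal_ofReal hr.le] using
    (hmem.of_exponent_ge (ENNReal.ofReal_le_ofReal hqr)).summable
      (by rwa [ENNReal.toReal_ofReal hr.le])

theorem IsWeaklySummable.exists_sum_norm_rpow_le (hq : 1 ≤ q) (hx : IsWeaklySummable 𝕜 q x) :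
    ∃ C : ℝ, 0 ≤ C ∧ ∀ (f : StrongDual 𝕜 X) (s : Finset ℕ),
      ∑ i ∈ s, ‖f (x i)‖ ^ q ≤ (C * ‖f‖) ^ q := by
  have hq_pos : 0 < q := by linarith
  have : Fact (1 ≤ ENNReal.ofReal q) := ⟨by simpa using ENNReal.ofReal_le_ofReal hq⟩
  let T (s : Finset ℕ) : StrongDual 𝕜 X →L[𝕜] lp (fun _ : ℕ => 𝕜) (ENNReal.ofReal q) :=
    ∑ i ∈ s, (lp.singleContinuousLinearMap 𝕜 (fun _ : ℕ => 𝕜) (ENNReal.ofReal q) i).comp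
      (NormedSpace.inclusionInDoubleDual 𝕜 X (x i))
  have norm_T (s : Finset ℕ) (f : StrongDual 𝕜 X) : ‖T s f‖ ^ q = ∑ i ∈ s, ‖f (x i)‖ ^ q := by
    have h := lp.norm_sum_single (p := ENNReal.ofReal q)
      (by rwa [ENNReal.toReal_ofReal hq_pos.le]) (fun i => f (x i)) s
    rw [ENNReal.toReal_ofReal hq_pos.le] at h
    rw [← h]
    simp [T]
  obtain ⟨C, hC⟩ : ∃ C, ∀ s, ‖T s‖ ≤ C := banach_steinhaus fun f => by
    refine ⟨(∑' i, ‖f (x i)‖ ^ q) ^ q⁻¹, fun s => ?_⟩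
    rw [Real.le_rpow_inv_iff_of_pos (norm_nonneg _) (tsum_nonneg fun i => by positivity) hq_pos,
      norm_T]
    exact (hx f).sum_le_tsum s fun i _ => by positivity
  refine ⟨C, (norm_nonneg (T ∅)).trans (hC ∅), fun f s => ?_⟩
  rw [← norm_T]
  gcongr
  exact (T s).le_of_opNorm_le (hC s) f

theorem exists_nat_mul_rpow_lt_mul {s c : ℝ} (hs : s < 1) (hc : 0 < c) (A : ℝ) :
    ∃ N : ℕ, A * (N : ℝ) ^ s < N * c := by
  have hlim : Tendsto (fun N : ℕ => (N : ℝ) ^ (1 - s)) atTop atTop :=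
    (tendsto_rpow_atTop (by linarith)).comp tendsto_natCast_atTop_atTop
  obtain ⟨N, hN, hN_pos⟩ :=
    ((hlim.eventually_gt_atTop (A / c)).and (eventually_gt_atTop 0)).exists
  have hN_pos : (0 : ℝ) < N := by exact_mod_cast hN_pos
  refine ⟨N, ?_⟩
  rwa [Real.rpow_sub hN_pos, Real.rpow_one, div_lt_div_iff₀ hc (by positivity)] at hN

theorem IsWeaklySummable.exists_sum_half_norm_diag_rpow_le (hx : IsWeaklySummable 𝕜 q x)
    (hq : 1 ≤ q) (hr : 0 ≤ r) {M : ℝ} {g : ℕ → StrongDual 𝕜 X}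
    (hg : ∀ S : Finset ℕ, ‖∑ j ∈ S, g j‖ ≤ M * (S.card : ℝ) ^ r) :
    ∃ A : ℝ, ∀ s : Finset ℕ,
      ∑ i ∈ s, (‖g i (x i)‖ / 2) ^ q ≤ A * (s.card : ℝ) ^ (r * q) := by
  obtain ⟨C, hC_nonneg, hC⟩ := hx.exists_sum_norm_rpow_le hq
  have hM : 0 ≤ M := by simpa using (norm_nonneg _).trans (hg {0})
  refine ⟨(C * M) ^ q, fun s => ?_⟩
  obtain ⟨S, hS, hle⟩ := exists_subset_sum_half_norm_diag_rpow_le hq s fun i j => g j (x i)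
  calc ∑ i ∈ s, (‖g i (x i)‖ / 2) ^ q
      ≤ ∑ i ∈ s, ‖(∑ j ∈ S, g j) (x i)‖ ^ q := by simpa only [sum_apply] using hle
    _ ≤ (C * ‖∑ j ∈ S, g j‖) ^ q := hC _ s
    _ ≤ (C * (M * (s.card : ℝ) ^ r)) ^ q := by
        gcongr
        exact (hg S).trans (by gcongr)
    _ = (C * M) ^ q * (s.card : ℝ) ^ (r * q) := by
        rw [← mul_assoc, Real.mul_rpow (by positivity) (by positivity),
          ← Real.rpow_mul (by positivity)]

theorem IsWeaklySummable.tendsto_apply_of_norm_sum_le (hx : IsWeaklySummable 𝕜 q x) (hq : 1 ≤ q)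
    (hr : 0 ≤ r) (hrq : r * q < 1) {M : ℝ} {g : ℕ → StrongDual 𝕜 X}
    (hg : ∀ S : Finset ℕ, ‖∑ j ∈ S, g j‖ ≤ M * (S.card : ℝ) ^ r) :
    Tendsto (fun i => g i (x i)) atTop (𝓝 0) := by
  obtain ⟨A, hA⟩ := hx.exists_sum_half_norm_diag_rpow_le hq hr hg
  rw [← Nat.cofinite_eq_atTop, Metric.tendsto_nhds]
  intro ε hε
  simp only [dist_zero_right, eventually_cofinite, not_lt]
  by_contra hinf
  obtain ⟨N, hN⟩ := exists_nat_mul_rpow_lt_mul hrq (show 0 < (ε / 2) ^ q by positivity) A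
  obtain ⟨s, hs, rfl⟩ := Set.Infinite.exists_subset_card_eq hinf N
  have hlower : s.card * (ε / 2) ^ q ≤ ∑ i ∈ s, (‖g i (x i)‖ / 2) ^ q := by
    rw [← nsmul_eq_mul]
    exact Finset.card_nsmul_le_sum _ _ _ fun i hi => by
      gcongr
      exact hs hi
  exact (hlower.trans (hA s)).not_gt hN

end WeaklySummable

section BlockProj

variable {𝕜 ι : Type*} [NontriviallyNormedField 𝕜] [DecidableEq ι] {E : ι → Type*}
  [∀ i, NormedAddCommGroup (E i)] [∀ i, NormedSpace 𝕜 (E i)] {p : ℝ≥0∞} [Fact (1 ≤ p)]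

variable (𝕜 E p) in
/-- The projection of an `ℓ_p`-sum onto the coordinates in a finite set `s`, as a map of the
`ℓ_p`-sum to itself. -/
noncomputable def blockProj (s : Finset ι) : lp E p →L[𝕜] lp E p :=
  ∑ i ∈ s, (lp.singleContinuousLinearMap 𝕜 E p i).comp (lp.evalCLM 𝕜 E p i)

theorem blockProj_apply (s : Finset ι) (x : lp E p) :
    blockProj 𝕜 E p s x = ∑ i ∈ s, lp.single p i (x i) := by
  simp only [blockProj, sum_apply]
  rfl

variable {κ : Type*} {s : κ → Finset ι}

theorem sum_norm_blockProj_rpow_le (hp : p ≠ ⊤) (hs : Pairwise (Function.onFun Disjoint s))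
    (S : Finset κ) (x : lp E p) :
    ∑ j ∈ S, ‖blockProj 𝕜 E p (s j) x‖ ^ p.toReal ≤ ‖x‖ ^ p.toReal := by
  have hp_pos : 0 < p.toReal := by linarith [(ENNReal.dichotomy p).resolve_left hp]
  simp only [blockProj_apply, lp.norm_sum_single hp_pos]
  rw [← Finset.sum_biUnion fun i _ j _ hij => hs hij]
  exact lp.sum_rpow_le_norm_rpow hp_pos x _

theorem sum_norm_blockProj_le (hp : p ≠ ⊤) (hs : Pairwise (Function.onFun Disjoint s))
    (S : Finset κ) (x : lp E p) :
    ∑ j ∈ S, ‖blockProj 𝕜 E p (s j) x‖ ≤ (S.card : ℝ) ^ (1 - p.toReal⁻¹) * ‖x‖ := by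
  have hp_one : 1 ≤ p.toReal := (ENNReal.dichotomy p).resolve_left hp
  have hp_pos : 0 < p.toReal := by linarith
  rw [← Real.rpow_le_rpow_iff (by positivity) (by positivity) hp_pos]
  calc (∑ j ∈ S, ‖blockProj 𝕜 E p (s j) x‖) ^ p.toReal
      ≤ (S.card : ℝ) ^ (p.toReal - 1) * ∑ j ∈ S, ‖blockProj 𝕜 E p (s j) x‖ ^ p.toReal :=
        Real.rpow_sum_le_const_mul_sum_rpow_of_nonneg S hp_one fun _ _ => norm_nonneg _
    _ ≤ (S.card : ℝ) ^ (p.toReal - 1) * ‖x‖ ^ p.toReal := by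
        gcongr
        exact sum_norm_blockProj_rpow_le hp hs S x
    _ = ((S.card : ℝ) ^ (1 - p.toReal⁻¹) * ‖x‖) ^ p.toReal := by
        rw [Real.mul_rpow (by positivity) (by positivity), ← Real.rpow_mul (by positivity),
          sub_mul, one_mul, inv_mul_cancel₀ hp_pos.ne']

theorem norm_sum_comp_blockProj_le {F : Type*} [SeminormedAddCommGroup F] [NormedSpace 𝕜 F]
    (hp : p ≠ ⊤) (hs : Pairwise (Function.onFun Disjoint s)) {M : ℝ} (hM : 0 ≤ M)
    {f : κ → lp E p →L[𝕜] F} (hf : ∀ j, ‖f j‖ ≤ M) (S : Finset κ) :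
    ‖∑ j ∈ S, (f j).comp (blockProj 𝕜 E p (s j))‖ ≤ M * (S.card : ℝ) ^ (1 - p.toReal⁻¹) := by
  refine ContinuousLinearMap.opNorm_le_bound _ (by positivity) fun x => ?_
  calc ‖(∑ j ∈ S, (f j).comp (blockProj 𝕜 E p (s j))) x‖
      = ‖∑ j ∈ S, f j (blockProj 𝕜 E p (s j) x)‖ := by
        simp only [sum_apply, ContinuousLinearMap.comp_apply]
    _ ≤ ∑ j ∈ S, M * ‖blockProj 𝕜 E p (s j) x‖ :=
        norm_sum_le_of_le S fun j _ => (f j).le_of_opNorm_le (hf j) _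
    _ = M * ∑ j ∈ S, ‖blockProj 𝕜 E p (s j) x‖ := by rw [Finset.mul_sum]
    _ ≤ M * ((S.card : ℝ) ^ (1 - p.toReal⁻¹) * ‖x‖) := by
        gcongr
        exact sum_norm_blockProj_le hp hs S x
    _ = M * (S.card : ℝ) ^ (1 - p.toReal⁻¹) * ‖x‖ := by rw [mul_assoc]

end BlockProj

section GlidingHump

theorem exists_strictMono_monotone_of_forall_exists {P : ℕ → ℕ → ℕ → Prop}
    (hP : ∀ a b, ∃ n > a, ∃ b' ≥ b, P n b b') :
    ∃ φ m : ℕ → ℕ, StrictMono φ ∧ Monotone m ∧ ∀ i, P (φ i) (m i) (m (i + 1)) := by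
  choose n hn b' hb' hPnb using hP
  let state : ℕ → ℕ × ℕ := fun i => Nat.rec (0, 0) (fun _ a => (n a.1 a.2, b' a.1 a.2)) i
  exact ⟨fun i => (state (i + 1)).1, fun i => (state i).2,
    strictMono_nat_of_lt_succ fun _ => hn _ _, monotone_nat_of_le_succ fun _ => hb' _ _,
    fun _ => hPnb _ _⟩

theorem pairwise_disjoint_finset_Ico {α : Type*} [PartialOrder α] [LocallyFiniteOrder α]
    {m : ℕ → α} (hm : Monotone m) :
    Pairwise (Function.onFun Disjoint fun i => Finset.Ico (m i) (m (i + 1))) := by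
  intro i j hij
  rw [Function.onFun, ← Finset.disjoint_coe, Finset.coe_Ico, Finset.coe_Ico]
  exact hm.pairwise_disjoint_on_Ico_succ hij

variable {𝕜 : Type*} [RCLike 𝕜] {X : ℕ → Type*} [∀ n, NormedAddCommGroup (X n)]
  [∀ n, NormedSpace 𝕜 (X n)] {p : ℝ≥0∞} [Fact (1 ≤ p)] {K : Set (StrongDual 𝕜 (lp X p))}
  {x : ℕ → lp X p}

theorem apply_blockProj (s : Finset ℕ) (f : StrongDual 𝕜 (lp X p)) (z : lp X p) :
    f (blockProj 𝕜 X p s z) = ∑ k ∈ s, dualProj k f (z k) := by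
  rw [blockProj_apply, map_sum]
  rfl

theorem tendsto_apply_blockProj_Ico (hp : p ≠ ⊤) (f : StrongDual 𝕜 (lp X p)) (z : lp X p)
    (m : ℕ) :
    Tendsto (fun m' => f (blockProj 𝕜 X p (Finset.Ico m m') z)) atTop
      (𝓝 (f z - f (blockProj 𝕜 X p (Finset.range m) z))) := by
  simp only [apply_blockProj]
  refine ((hasSum_dualProj hp f z).tendsto_sum_nat.sub_const _).congr' ?_
  filter_upwards [eventually_ge_atTop m] with m' hm'
  rw [Finset.sum_Ico_eq_sub _ hm']

theorem tendstoUniformlyOn_apply_blockProj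
    (hcoord : ∀ k, TendstoUniformlyOn (fun n (f : StrongDual 𝕜 (lp X p)) => dualProj k f (x n k))
      (fun _ => (0 : 𝕜)) atTop K) (s : Finset ℕ) :
    TendstoUniformlyOn (fun n (f : StrongDual 𝕜 (lp X p)) => f (blockProj 𝕜 X p s (x n)))
      (fun _ => (0 : 𝕜)) atTop K := by
  simp only [apply_blockProj]
  induction s using Finset.induction_on with
  | empty =>
    simpa only [Finset.sum_empty] using tendsto_const_nhds.tendstoUniformlyOn_const K
  | insert k s hk ih =>
    simp only [Finset.sum_insert hk]
    simpa only [Pi.add_def, add_zero] using (hcoord k).add ih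

theorem exists_half_le_norm_apply_blockProj_Ico (hp : p ≠ ⊤)
    (hcoord : ∀ k, TendstoUniformlyOn (fun n (f : StrongDual 𝕜 (lp X p)) => dualProj k f (x n k))
      (fun _ => (0 : 𝕜)) atTop K)
    {ε : ℝ} (hε : 0 < ε) (hfreq : ∃ᶠ n in atTop, ∃ f ∈ K, ε ≤ ‖f (x n)‖) (n₀ m : ℕ) :
    ∃ n > n₀, ∃ m' ≥ m, ∃ f ∈ K, ε / 2 ≤ ‖f (blockProj 𝕜 X p (Finset.Ico m m') (x n))‖ := by
  have hhead : ∀ᶠ n in atTop, ∀ f ∈ K, ‖f (blockProj 𝕜 X p (Finset.range m) (x n))‖ < ε / 2 := by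
    simpa only [dist_zero_left] using Metric.tendstoUniformlyOn_iff.1
      (tendstoUniformlyOn_apply_blockProj hcoord (Finset.range m)) (ε / 2) (by positivity)
  obtain ⟨n, ⟨f, hfK, hf⟩, hn_head, hn⟩ :=
    (hfreq.and_eventually (hhead.and (eventually_gt_atTop n₀))).exists
  have htail : ε / 2 < ‖f (x n) - f (blockProj 𝕜 X p (Finset.range m) (x n))‖ := by
    linarith [norm_sub_norm_le (f (x n)) (f (blockProj 𝕜 X p (Finset.range m) (x n))),
      hn_head f hfK]
  obtain ⟨m', hm'_tail, hm'⟩ :=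
    (((tendsto_apply_blockProj_Ico hp f (x n) m).norm.eventually_const_lt htail).and
      (eventually_ge_atTop m)).exists
  exact ⟨n, hn, m', hm', f, hfK, hm'_tail.le⟩

theorem exists_gliding_hump (hp : p ≠ ⊤)
    (hcoord : ∀ k, TendstoUniformlyOn (fun n (f : StrongDual 𝕜 (lp X p)) => dualProj k f (x n k))
      (fun _ => (0 : 𝕜)) atTop K)
    (hx : ¬ TendstoUniformlyOn (fun n (f : StrongDual 𝕜 (lp X p)) => f (x n))
      (fun _ => (0 : 𝕜)) atTop K) :
    ∃ δ > 0, ∃ (φ m : ℕ → ℕ) (f : ℕ → StrongDual 𝕜 (lp X p)), StrictMono φ ∧ Monotone m ∧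
      (∀ i, f i ∈ K) ∧
      ∀ i, δ ≤ ‖f i (blockProj 𝕜 X p (Finset.Ico (m i) (m (i + 1))) (x (φ i)))‖ := by
  simp only [Metric.tendstoUniformlyOn_iff, dist_zero_left] at hx
  push Not at hx
  obtain ⟨ε, hε, hfreq⟩ := hx
  obtain ⟨φ, m, hφ, hm, hblock⟩ := exists_strictMono_monotone_of_forall_exists
    (exists_half_le_norm_apply_blockProj_Ico hp hcoord hε hfreq)
  choose f hfK hf using hblock
  exact ⟨ε / 2, by positivity, φ, m, f, hφ, hm, hfK, hf⟩

theorem IsWeaklySummable.tendstoUniformlyOn_of_coord {q : ℝ} (hx : IsWeaklySummable 𝕜 q x)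
    (hp : p ≠ ⊤) (hq : 0 < q) (hpq : (1 - p.toReal⁻¹) * q < 1) (hK : Bornology.IsBounded K)
    (hcoord : ∀ k, TendstoUniformlyOn (fun n (f : StrongDual 𝕜 (lp X p)) => dualProj k f (x n k))
      (fun _ => (0 : 𝕜)) atTop K) :
    TendstoUniformlyOn (fun n (f : StrongDual 𝕜 (lp X p)) => f (x n))
      (fun _ => (0 : 𝕜)) atTop K := by
  by_contra hcon
  obtain ⟨δ, hδ, φ, m, f, hφ, hm, hfK, hf⟩ := exists_gliding_hump hp hcoord hcon
  obtain ⟨M, hM, hKM⟩ := hK.exists_pos_norm_le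
  have hp_one : 1 ≤ p.toReal := (ENNReal.dichotomy p).resolve_left hp
  have hr : 0 ≤ 1 - p.toReal⁻¹ := sub_nonneg.2 (inv_le_one_of_one_le₀ hp_one)
  have hr_max : (1 - p.toReal⁻¹) * max q 1 < 1 := by
    have hp_inv : 0 < p.toReal⁻¹ := inv_pos.2 (by linarith)
    rw [mul_max_of_nonneg _ _ hr]
    exact max_lt hpq (by linarith)
  have hy : IsWeaklySummable 𝕜 (max q 1) (x ∘ φ) :=
    (hx.mono hq (le_max_left q 1)).comp_injective hφ.injective
  have hlim := hy.tendsto_apply_of_norm_sum_le (le_max_right q 1) hr hr_max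
    (norm_sum_comp_blockProj_le hp (pairwise_disjoint_finset_Ico hm) hM.le
      fun j => hKM _ (hfK j))
  have hδ_le : δ ≤ 0 := by simpa using ge_of_tendsto' hlim.norm hf
  exact hδ_le.not_gt hδ

end GlidingHump

section ConjExponent

variable {p : ℝ≥0∞} {q : ℝ}

theorem one_sub_inv_toReal_mul_lt_one [Fact (1 ≤ p)] (hq : 0 ≤ q)
    (hpq : ENNReal.ofReal q < p.conjExponent) : (1 - p.toReal⁻¹) * q < 1 := by
  have hinv : p⁻¹ + p.conjExponent⁻¹ = 1 :=
    ENNReal.HolderConjugate.inv_add_inv_eq_one p p.conjExponent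
  have hinv_real : 1 - p.toReal⁻¹ = p.conjExponent⁻¹.toReal := by
    rw [sub_eq_iff_eq_add', ← ENNReal.toReal_inv, ← ENNReal.toReal_add, hinv, ENNReal.toReal_one]
    · exact ne_top_of_le_ne_top ENNReal.one_ne_top (hinv ▸ le_self_add)
    · exact ne_top_of_le_ne_top ENNReal.one_ne_top (hinv ▸ le_add_self)
  have hmul : p.conjExponent⁻¹ * ENNReal.ofReal q < 1 := by
    rw [mul_comm, ← div_eq_mul_inv]
    exact ENNReal.div_lt_of_lt_mul (by rwa [one_mul])
  calc (1 - p.toReal⁻¹) * q = (p.conjExponent⁻¹ * ENNReal.ofReal q).toReal := by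
        rw [hinv_real, ENNReal.toReal_mul, ENNReal.toReal_ofReal hq]
    _ < 1 := ENNReal.toReal_one ▸ (ENNReal.toReal_lt_toReal hmul.ne_top ENNReal.one_ne_top).2 hmul

theorem ofReal_lt_conjExponent_iff (hp_one : 1 < p) (hp_top : p < ⊤) (hq : 0 ≤ q) :
    ENNReal.ofReal q < p.conjExponent ↔ q < Real.conjExponent p.toReal := by
  have : Fact (1 ≤ p) := ⟨hp_one.le⟩
  have hconj : p.toReal.HolderConjugate p.conjExponent.toReal :=
    ENNReal.HolderConjugate.toReal <| by
      simpa using (ENNReal.toReal_lt_toReal ENNReal.one_ne_top hp_top.ne).2 hp_one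
  rw [ENNReal.ofReal_lt_iff_lt_toReal hq (ENNReal.toReal_pos_iff.1 hconj.symm.pos).2.ne,
    hconj.conjugate_eq, Real.conjExponent]

end ConjExponent

end RightSets

theorem theorem3p21_general {𝕜 : Type*} [RCLike 𝕜]
    {X : ℕ → Type*} [∀ n, NormedAddCommGroup (X n)] [∀ n, NormedSpace 𝕜 (X n)]
    (p : ℝ≥0∞) [Fact (1 ≤ p)] (hp_top : p < ⊤)
    (q : ℝ) (hq_pos : 0 < q) (hq_lt : ENNReal.ofReal q < p.conjExponent)
    (K : Set (StrongDual 𝕜 (lp X p))) (hK : Bornology.IsBounded K) :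
    RightSets.IsRightSet q K ↔
      ∀ n, RightSets.IsRightSet q (RightSets.dualProj n '' K) := by
  refine ⟨fun h n => h.image_comp (lp.singleContinuousLinearMap 𝕜 X p n), fun h => ⟨hK, ?_⟩⟩
  intro x hx
  exact hx.2.tendstoUniformlyOn_of_coord hp_top.ne hq_pos
    (RightSets.one_sub_inv_toReal_mul_lt_one hq_pos.le hq_lt) hK fun k =>
      RightSets.tendstoUniformlyOn_image_iff.1 ((h k).2 _ (hx.map (lp.evalCLM 𝕜 X p k)))

theorem theorem3p21 {𝕜 : Type*} [RCLike 𝕜]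
    {X : ℕ → Type*} [∀ n, NormedAddCommGroup (X n)] [∀ n, NormedSpace 𝕜 (X n)]
    [∀ n, CompleteSpace (X n)]
    (p : ℝ≥0∞) [Fact (1 ≤ p)] (hp_one : 1 < p) (hp_top : p < ⊤)
    (q : ℝ) (hq_one : 1 ≤ q) (hq_lt : q < Real.conjExponent p.toReal)
    (K : Set (StrongDual 𝕜 (lp X p))) (hK : Bornology.IsBounded K) :
    RightSets.IsRightSet q K ↔
      ∀ n, RightSets.IsRightSet q (RightSets.dualProj n '' K) := by
  have hq_pos : 0 < q := by linarith
  exact theorem3p21_general p hp_top q hq_pos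
    ((RightSets.ofReal_lt_conjExponent_iff hp_one hp_top hq_pos.le).2 hq_lt) K hK
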